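/- Let $K\subset\mathbb{R}$ be a totally real number field of degree $d\ge 2$ over $\mathbb{Q}$. Let $\wp_K$ be the set of Pisot numbers $\theta\in K$ with $K=\mathbb{Q}(\theta)$ (a Pisot number is a real algebraic integer $>1$ all of whose other conjugates have modulus $<1$). Let $D_K$ be the set of positive differences $\theta'-\theta$ with $\theta<\theta'$ in $\wp_K$, and let $F_K\subset D_K$ be the set of those differences for which $\theta<\theta'$ are consecutive elements of $\wp_K$. Let $E_K$ be the set of positive algebraic integers $\beta\in K$ such that $|\sigma(\beta)|\in(0,2)$ for every embedding $\sigma$ of $K$ into $\mathbb{C}$ other than the identity. A Salem number is a real algebraic integer $\tau>1$ whose other conjugates have modulus at most $1$, at least one conjugate having modulus $1$; a Salem trace number is a number $\tau+\tau^{-1}$ with $\tau$ a Salem number. Let $U_K$ be the set of root of unity trace numbers in $K$, that is, of the positive numbers in $K$ of the form $2\cos(2k\pi/n)$ with $n\ge 4$, $1\le k\le n-1$ and $\gcd(k,n)=1$. Put $T_K:=E_K\cap(2,\infty)$. Then: (i) $D_K=E_K$. (ii) $U_K=E_K\cap(0,2)=D_K\cap(0,2)$. (iii) $T_K=D_K\cap(2,\infty)$,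 and $T_K$ is the set of Salem trace numbers $\beta\in K$ with $K=\mathbb{Q}(\beta)$. The sets $T_K$ and $U_K$ are non-empty and disjoint and their union is $D_K$, and every element of $T_K$ has degree $d$ over $\mathbb{Q}$. (iv) $F_K$ is finite and $\operatorname{card}(F_K)\ge 2^{d-1}$. (v) $U_K$ is finite, $F_K\cap(0,2)\subset U_K$, $\min F_K=\min U_K\le 1$, and if $\operatorname{card}(U_K)\ge 2$, then the second smallest element of $F_K$ is the second smallest element of $U_K$. (vi) If $\operatorname{card}(U_K)=1$, then $\min F_K=1$, and the second smallest element of $F_K$ is $\min T_K$, which is the smallest Salem trace number of degree $d$ lying in $K$. -/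

import Mathlib

namespace PisotGaps

/-- A Pisot number: a real algebraic integer greater than `1` whose other conjugates (over `ℚ`,
in `ℂ`) have modulus less than `1`. -/
def IsPisot (θ : ℝ) : Prop :=
  IsIntegral ℤ θ ∧ 1 < θ ∧ ∀ z : ℂ, IsConjRoot ℚ (θ : ℂ) z → z ≠ (θ : ℂ) → ‖z‖ < 1

/-- A Salem number: a real algebraic integer greater than `1` whose other conjugates have modulus
at most `1`, at least one conjugate having modulus `1`. -/
def IsSalem (τ : ℝ) : Prop :=
  IsIntegral ℤ τ ∧ 1 < τ ∧ (∀ z : ℂ, IsConjRoot ℚ (τ : ℂ) z → z ≠ (τ : ℂ) → ‖z‖ ≤ 1) ∧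
    ∃ z : ℂ, IsConjRoot ℚ (τ : ℂ) z ∧ ‖z‖ = 1

/-- A Salem trace number: `τ + τ⁻¹` for a Salem number `τ`. -/
def IsSalemTrace (β : ℝ) : Prop :=
  ∃ τ : ℝ, IsSalem τ ∧ β = τ + τ⁻¹

/-- A root of unity trace number: a positive number `2 cos (2kπ/n)` with `n ≥ 4`,
`1 ≤ k ≤ n - 1` and `gcd (k, n) = 1`. -/
def IsRootOfUnityTrace (u : ℝ) : Prop :=
  0 < u ∧ ∃ n k : ℕ, 4 ≤ n ∧ 1 ≤ k ∧ k < n ∧ Nat.Coprime k n ∧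
    u = 2 * Real.cos (2 * (k : ℝ) * Real.pi / (n : ℝ))

/-- The set `℘_K` of the Pisot numbers `θ ∈ K` with `ℚ(θ) = K`. -/
def pisotSet (K : IntermediateField ℚ ℝ) : Set ℝ :=
  {θ | IsPisot θ ∧ θ ∈ K ∧ IntermediateField.adjoin ℚ {θ} = K}

/-- The set `D_K` of the positive differences of two elements of `℘_K`. -/
def diffSet (K : IntermediateField ℚ ℝ) : Set ℝ :=
  {x | ∃ θ ∈ pisotSet K, ∃ θ' ∈ pisotSet K, θ < θ' ∧ x = θ' - θ}

/-- The set `F_K` of the differences `θ' - θ` of two consecutive elements `θ < θ'` of `℘_K`. -/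
def gapSet (K : IntermediateField ℚ ℝ) : Set ℝ :=
  {x | ∃ θ ∈ pisotSet K, ∃ θ' ∈ pisotSet K, θ < θ' ∧
    (∀ η ∈ pisotSet K, ¬ (θ < η ∧ η < θ')) ∧ x = θ' - θ}

/-- The identity of `K ⊆ ℝ`, seen as an embedding of `K` into `ℂ`. -/
noncomputable def idEmbedding (K : IntermediateField ℚ ℝ) : K →+* ℂ :=
  Complex.ofRealHom.comp (algebraMap K ℝ)

/-- The set `E_K` of the positive algebraic integers of `K` whose images under all embeddings of
`K` into `ℂ` other than the identity have absolute value in `(0, 2)`. -/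
def smallConjSet (K : IntermediateField ℚ ℝ) : Set ℝ :=
  {β | ∃ b : K, (b : ℝ) = β ∧ IsIntegral ℤ b ∧ 0 < β ∧
    ∀ σ : K →+* ℂ, σ ≠ idEmbedding K → ‖σ b‖ ∈ Set.Ioo (0 : ℝ) 2}

/-- The set `U_K` of the root of unity trace numbers lying in `K`. -/
def rootTraceSet (K : IntermediateField ℚ ℝ) : Set ℝ :=
  {u | IsRootOfUnityTrace u ∧ u ∈ K}

/-- The set `T_K = E_K ∩ (2, ∞)`. -/
def salemTraceSet (K : IntermediateField ℚ ℝ) : Set ℝ :=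
  smallConjSet K ∩ Set.Ioi 2

/-- The degree over `ℚ` of a real algebraic number. -/
noncomputable def algDegree (x : ℝ) : ℕ := (minpoly ℚ x).natDegree

/-- `x` is the second smallest element of `S`. -/
def IsSecondLeast (S : Set ℝ) (x : ℝ) : Prop :=
  ∃ a, IsLeast S a ∧ IsLeast (S \ {a}) x

end PisotGaps

/-! Embed `K` by all its embeddings; they are real, so an integer of `K` is a lattice point in
`ℝ^d`. An element of `pisotSet K` is an integer that exceeds 1 and has every non-identity coordinate
in the window `(-1, 1)`. A difference of two such points has those coordinates in `(-2, 2)`, nonzero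
because embeddings are injective. Conversely, by `exists_integer_approx` (Minkowski plus
cocompactness) the non-identity coordinates of an integer can be prescribed up to any error with the
identity coordinate large, so every element of `smallConjSet K` is a difference.

Below 2 all conjugates lie in `[-2, 2]`, and Kronecker's argument with Chebyshev polynomials gives
the root of unity traces. Above 2, solving `τ + τ⁻¹ = β` puts the other conjugates on the unit
circle and gives Salem numbers.

Gaps are bounded, because a small sign-adapted integer can always be added to a Pisot number; with
discreteness this makes them finite in number. Pisot numbers near the `2^(d-1)` corners of the
window have following gaps with distinct sign patterns. For the least gaps, a difference that is not
a gap is a sum of two differences. So the least difference `u` is a gap, and the second could fail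
only by being `2u`; but `u ≤ 1` has another conjugate of modulus at least 1 by the norm, which
excludes `2u`. -/

namespace PisotGaps

open NumberField

/-! ### Conjugates as embeddings, and approximation by algebraic integers -/

section Embeddings

variable (K : IntermediateField ℚ ℝ)

@[simp]
lemma idEmbedding_apply (a : K) : idEmbedding K a = ((a : ℝ) : ℂ) := rfl

variable {K} in
lemma norm_idEmbedding (a : K) : ‖idEmbedding K a‖ = |(a : ℝ)| := by simp

variable {K} in
lemma coe_re_apply [IsTotallyReal K] (σ : K →+* ℂ) (a : K) : ((σ a).re : ℂ) = σ a := by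
  have := IsTotallyReal.complexEmbedding_isReal σ
  exact Complex.conj_eq_iff_re.1 (RingHom.congr_fun this a)

variable {K} in
lemma norm_apply_eq_abs_re [IsTotallyReal K] (σ : K →+* ℂ) (a : K) : ‖σ a‖ = |(σ a).re| := by
  rw [← coe_re_apply σ a, Complex.norm_real, Complex.ofReal_re, Real.norm_eq_abs]

variable {K} in
lemma mk_ne_mk_of_ne [IsTotallyReal K] {σ τ : K →+* ℂ} (h : σ ≠ τ) :
    InfinitePlace.mk σ ≠ InfinitePlace.mk τ := by
  intro h'
  rcases InfinitePlace.mk_eq_iff.1 h' with h' | h'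
  · exact h h'
  · exact h ((IsTotallyReal.complexEmbedding_isReal σ).symm.trans h')

variable [NumberField K]

variable {K} in
lemma isConjRoot_coe_iff (a : K) (z : ℂ) :
    IsConjRoot ℚ ((a : ℝ) : ℂ) z ↔ ∃ σ : K →+* ℂ, σ a = z := by
  have hint : IsIntegral ℚ a := Algebra.IsIntegral.isIntegral a
  have h1 : minpoly ℚ ((a : ℝ) : ℂ) = minpoly ℚ a :=
    minpoly.algHom_eq (idEmbedding K).toRatAlgHom (idEmbedding K).injective a
  have h2 : IsIntegral ℚ ((a : ℝ) : ℂ) := hint.map (idEmbedding K).toRatAlgHom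
  have h3 := congrArg (z ∈ ·) (Embeddings.range_eval_eq_rootSet_minpoly K ℂ a)
  simp only [Set.mem_range, eq_iff_iff] at h3
  rw [h3, isConjRoot_iff_mem_minpoly_rootSet h2, h1]

variable {K} in
lemma adjoin_eq_iff (a : K) :
    IntermediateField.adjoin ℚ {(a : ℝ)} = K ↔
      ∀ σ : K →+* ℂ, σ a = ((a : ℝ) : ℂ) → σ = idEmbedding K := by
  have h0 : IntermediateField.adjoin ℚ {(a : ℝ)} = K ↔
      IntermediateField.adjoin ℚ {a} = ⊤ := by
    have := (IntermediateField.lift_injective K).eq_iff (a := IntermediateField.adjoin ℚ {a})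
      (b := ⊤)
    rwa [IntermediateField.lift_top, IntermediateField.lift_adjoin_simple] at this
  rw [h0, Field.primitive_element_iff_algHom_eq_of_eval ℚ ℂ (fun x => IsAlgClosed.splits _) a
    (idEmbedding K).toRatAlgHom]
  constructor
  · intro h σ hσ
    have := h σ.toRatAlgHom (by simpa using hσ.symm)
    exact (congrArg AlgHom.toRingHom this).symm
  · intro h ψ hψ
    have := h ψ.toRingHom (by simpa using hψ.symm)
    ext x
    exact (congrArg (fun f : K →+* ℂ => f x) this).symm

variable {K} in
lemma adjoin_eq_of_norm_lt {a : K} {c : ℝ} (ha : c ≤ (a : ℝ))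
    (h : ∀ σ : K →+* ℂ, σ ≠ idEmbedding K → ‖σ a‖ < c) :
    IntermediateField.adjoin ℚ {(a : ℝ)} = K := by
  rw [adjoin_eq_iff]
  intro σ hσ
  by_contra hne
  have := h σ hne
  rw [hσ, Complex.norm_real, Real.norm_eq_abs] at this
  linarith [le_abs_self (a : ℝ)]

/-- Generation turns "every other conjugate" into "every other embedding", since no other embedding
fixes a generator. Conversely the bounds themselves force generation. -/
lemma mem_pisotSet_iff (θ : ℝ) :
    θ ∈ pisotSet K ↔ ∃ a : K, (a : ℝ) = θ ∧ IsIntegral ℤ a ∧ 1 < θ ∧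
      ∀ σ : K →+* ℂ, σ ≠ idEmbedding K → ‖σ a‖ < 1 := by
  constructor
  · rintro ⟨⟨hint, h1, hc⟩, hK, hadj⟩
    refine ⟨⟨θ, hK⟩, rfl, ?_, h1, fun σ hσ => ?_⟩
    · rwa [← isIntegral_algebraMap_iff (B := ℝ) (algebraMap K ℝ).injective]
    · refine hc _ ((isConjRoot_coe_iff (⟨θ, hK⟩ : K) _).2 ⟨σ, rfl⟩) fun h => hσ ?_
      exact (adjoin_eq_iff (⟨θ, hK⟩ : K)).1 hadj σ h
  · rintro ⟨a, rfl, hint, h1, hc⟩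
    refine ⟨⟨hint.map (algebraMap K ℝ).toIntAlgHom, h1, fun z hz hne => ?_⟩, a.2,
      adjoin_eq_of_norm_lt h1.le hc⟩
    obtain ⟨σ, rfl⟩ := (isConjRoot_coe_iff a z).1 hz
    exact hc σ fun h => hne (by rw [h]; rfl)

lemma exists_ne_idEmbedding (h : 2 ≤ Module.finrank ℚ K) :
    ∃ σ : K →+* ℂ, σ ≠ idEmbedding K := by
  classical
  rw [← NumberField.Embeddings.card K ℂ] at h
  exact Fintype.exists_ne_of_one_lt_card h _

variable [IsTotallyReal K]

open scoped NNReal in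
/-- Minkowski: a nonzero integer that is small under every embedding except the identity. -/
lemma exists_small_integer {ε : ℝ} (hε : 0 < ε) :
    ∃ a : K, IsIntegral ℤ a ∧ a ≠ 0 ∧ ∀ σ : K →+* ℂ, σ ≠ idEmbedding K → ‖σ a‖ < ε := by
  classical
  let B : ℝ≥0 := (mixedEmbedding.minkowskiBound K 1).toNNReal + 1
  have hlt : mixedEmbedding.minkowskiBound K 1 < (B : ENNReal) := by
    have := mixedEmbedding.minkowskiBound_lt_top K 1
    rw [← ENNReal.coe_toNNReal this.ne, ENNReal.coe_lt_coe]
    exact lt_add_one _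
  -- The box has side `ε` at every other place; its side at the identity is stretched until its
  -- volume exceeds the Minkowski bound.
  obtain ⟨g, hg, hprod⟩ := mixedEmbedding.adjust_f K (w₁ := InfinitePlace.mk (idEmbedding K))
    (f := fun _ => ⟨ε, hε.le⟩) B (fun w _ h => hε.ne' (congrArg NNReal.toReal h))
  have hvol : mixedEmbedding.minkowskiBound K ↑1 <
      MeasureTheory.volume (mixedEmbedding.convexBodyLT K g) := by
    rw [mixedEmbedding.convexBodyLT_volume, hprod]
    refine hlt.trans_le ?_
    have h1 : (1 : ENNReal) ≤ (mixedEmbedding.convexBodyLTFactor K : ENNReal) := by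
      exact_mod_cast mixedEmbedding.one_le_convexBodyLTFactor K
    calc (B : ENNReal) = 1 * B := (one_mul _).symm
      _ ≤ _ := by gcongr
  obtain ⟨a, ha0, ha⟩ := mixedEmbedding.exists_ne_zero_mem_ringOfIntegers_lt K hvol
  refine ⟨a, a.isIntegral_coe, by simpa using ha0, fun σ hσ => ?_⟩
  have := ha (InfinitePlace.mk σ)
  rw [hg _ (mk_ne_mk_of_ne hσ)] at this
  exact this

/-- The ring of integers is a cocompact lattice. -/
lemma exists_integer_near : ∃ C : ℝ, 0 < C ∧ ∀ x : (K →+* ℂ) → ℝ,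
    ∃ a : K, IsIntegral ℤ a ∧ ∀ σ : K →+* ℂ, |(σ a).re - x σ| ≤ C := by
  classical
  let b := canonicalEmbedding.latticeBasis K
  let e := integralBasis K
  refine ⟨1 + ∑ σ : K →+* ℂ, ∑ i, |(σ (e i)).re|, ?_, fun x => ?_⟩
  · have : 0 ≤ ∑ σ : K →+* ℂ, ∑ i, |(σ (e i)).re| :=
      Finset.sum_nonneg fun _ _ => Finset.sum_nonneg fun _ _ => abs_nonneg _
    linarith
  let y : (K →+* ℂ) → ℂ := fun σ => (x σ : ℂ)
  -- Round the coordinates of `x` in an integral basis. They may be replaced by their real parts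
  -- because all embeddings are real.
  let c := fun i => (b.repr y i).re
  have hx : ∀ σ, x σ = ∑ i, c i * (σ (e i)).re := by
    intro σ
    have h := congrArg (fun f : (K →+* ℂ) → ℂ => (f σ).re) (b.sum_repr y)
    simp only [Finset.sum_apply, Pi.smul_apply, smul_eq_mul, Complex.re_sum] at h
    rw [show x σ = (y σ).re from rfl, ← h]
    refine Finset.sum_congr rfl fun i _ => ?_
    rw [show b i σ = σ (e i) by
      simp only [b, canonicalEmbedding.latticeBasis_apply]; rfl]
    rw [← coe_re_apply σ (e i), Complex.re_mul_ofReal, Complex.ofReal_re]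
  refine ⟨∑ i, (round (c i) : K) * e i, ?_, fun σ => ?_⟩
  · refine IsIntegral.sum _ fun i _ => IsIntegral.mul ?_ ?_
    · exact isIntegral_algebraMap (R := ℤ) (x := round (c i))
    · simp only [e, integralBasis_apply]
      exact RingOfIntegers.isIntegral_coe _
  · have h1 : (σ (∑ i, (round (c i) : K) * e i)).re = ∑ i, (round (c i) : ℝ) * (σ (e i)).re := by
      rw [map_sum, Complex.re_sum]
      refine Finset.sum_congr rfl fun i _ => ?_
      rw [map_mul, map_intCast, ← Complex.ofReal_intCast, Complex.re_ofReal_mul]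
    rw [h1, hx, ← Finset.sum_sub_distrib]
    calc _ ≤ ∑ i, |(round (c i) : ℝ) * (σ (e i)).re - c i * (σ (e i)).re| :=
          Finset.abs_sum_le_sum_abs _ _
      _ ≤ ∑ i, |(σ (e i)).re| := by
          refine Finset.sum_le_sum fun i _ => ?_
          rw [← sub_mul, abs_mul, abs_sub_comm]
          have := abs_sub_round (c i)
          nlinarith [abs_nonneg (σ (e i)).re]
      _ ≤ ∑ σ : K →+* ℂ, ∑ i, |(σ (e i)).re| :=
          Finset.single_le_sum (f := fun σ : K →+* ℂ => ∑ i, |(σ (e i)).re|)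
            (fun _ _ => Finset.sum_nonneg fun _ _ => abs_nonneg _) (Finset.mem_univ σ)
      _ ≤ _ := by linarith

/-- Integers with prescribed approximate images under all embeddings except the identity. -/
lemma exists_integer_approx (x : (K →+* ℂ) → ℝ) {ε : ℝ} (hε : 0 < ε) (N : ℝ) :
    ∃ a : K, IsIntegral ℤ a ∧ N < (a : ℝ) ∧
      ∀ σ : K →+* ℂ, σ ≠ idEmbedding K → |(σ a).re - x σ| < ε := by
  classical
  obtain ⟨C, hC, hnear⟩ := exists_integer_near K
  obtain ⟨α, hαint, hα0, hα⟩ := exists_small_integer K (div_pos hε hC)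
  have hre : ∀ σ : K →+* ℂ, (σ α).re ≠ 0 := fun σ h => by
    have h2 := coe_re_apply σ α
    rw [h] at h2
    exact hα0 ((map_eq_zero σ).1 (by simpa using h2.symm))
  -- Approximate the target divided by `α`, then multiply back: the error `C` shrinks to `‖σ α‖ * C
  -- < ε`. At the identity it becomes `|α| * C`, for which the target makes allowance.
  let x' : (K →+* ℂ) → ℝ := fun σ =>
    (if σ = idEmbedding K then N + 1 + |(α : ℝ)| * C else x σ) / (σ α).re
  obtain ⟨a, ha, hax⟩ := hnear x'
  have key : ∀ σ : K →+* ℂ, |(σ (α * a)).re -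
      (if σ = idEmbedding K then N + 1 + |(α : ℝ)| * C else x σ)| ≤ ‖σ α‖ * C := by
    intro σ
    have h1 : (σ (α * a)).re = (σ α).re * (σ a).re := by
      rw [map_mul, ← coe_re_apply σ α, Complex.re_ofReal_mul, Complex.ofReal_re]
    have h2 : (if σ = idEmbedding K then N + 1 + |(α : ℝ)| * C else x σ) = (σ α).re * x' σ := by
      simp only [x']
      field_simp [hre σ]
    rw [h1, h2, ← mul_sub, abs_mul, norm_apply_eq_abs_re]
    exact mul_le_mul_of_nonneg_left (hax σ) (abs_nonneg _)
  refine ⟨α * a, hαint.mul ha, ?_, fun σ hσ => ?_⟩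
  · have h := key (idEmbedding K)
    rw [if_pos rfl, norm_idEmbedding, idEmbedding_apply, Complex.ofReal_re] at h
    linarith [(abs_le.1 h).1]
  · have h := key σ
    rw [if_neg hσ] at h
    refine h.trans_lt ?_
    have := hα σ hσ
    rwa [lt_div_iff₀ hC] at this

end Embeddings

/-! ### Differences of Pisot numbers; finiteness and number of gaps -/

section Gaps

lemma exists_pos_forall_lt {ι : Type*} [Finite ι] (p : ι → Prop) (δ : ι → ℝ)
    (h : ∀ i, p i → 0 < δ i) : ∃ ε > 0, ∀ i, p i → ε < δ i := by
  have h1 : ∀ᶠ ε : ℝ in nhdsWithin 0 (Set.Ioi 0), ∀ i, p i → ε < δ i := by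
    rw [Filter.eventually_all]
    intro i
    by_cases hp : p i
    · filter_upwards [nhdsWithin_le_nhds (eventually_lt_nhds (h i hp))] with ε hε _ using hε
    · exact Filter.Eventually.of_forall fun _ h => absurd h hp
  exact ((eventually_mem_nhdsWithin (a := (0 : ℝ)) (s := Set.Ioi 0)).and h1).exists

variable (K : IntermediateField ℚ ℝ)

lemma gapSet_subset_diffSet : gapSet K ⊆ diffSet K := by
  rintro x ⟨θ, hθ, θ', hθ', hlt, -, rfl⟩
  exact ⟨θ, hθ, θ', hθ', hlt, rfl⟩

variable [NumberField K]

/-- Only finitely many integers of `K` have all conjugates bounded. This is the discreteness behind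
every minimum taken below. -/
lemma finite_smallConjSet_inter_Iic (R : ℝ) : (smallConjSet K ∩ Set.Iic R).Finite := by
  refine ((Embeddings.finite_of_norm_le K ℂ (max R 2)).image (fun b : K => (b : ℝ))).subset ?_
  rintro _ ⟨⟨b, rfl, hb, hpos, hσ⟩, hR⟩
  refine ⟨b, ⟨hb, fun σ => ?_⟩, rfl⟩
  by_cases h : σ = idEmbedding K
  · rw [h, norm_idEmbedding, abs_of_pos hpos]
    exact le_max_of_le_left hR
  · exact le_max_of_le_right (hσ σ h).2.le

lemma diffSet_subset_smallConjSet : diffSet K ⊆ smallConjSet K := by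
  rintro x ⟨θ, hθ, θ', hθ', hlt, rfl⟩
  obtain ⟨a, rfl, ha, -, haσ⟩ := (mem_pisotSet_iff K θ).1 hθ
  obtain ⟨b, rfl, hb, -, hbσ⟩ := (mem_pisotSet_iff K θ').1 hθ'
  refine ⟨b - a, by simp, hb.sub ha, sub_pos.2 hlt, fun σ hσ => ⟨?_, ?_⟩⟩
  · rw [norm_pos_iff, map_ne_zero, sub_ne_zero]
    rintro rfl
    exact lt_irrefl _ hlt
  · rw [map_sub]
    linarith [norm_sub_le (σ b) (σ a), haσ σ hσ, hbσ σ hσ]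

lemma exists_consecutive {R θ : ℝ} (hθ : θ ∈ pisotSet K)
    (h : ∃ θ' ∈ pisotSet K, θ < θ' ∧ θ' ≤ θ + R) :
    ∃ θ' ∈ pisotSet K, θ < θ' ∧ ∀ η ∈ pisotSet K, ¬ (θ < η ∧ η < θ') := by
  let S : Set ℝ := {x | 0 < x ∧ x ≤ R ∧ θ + x ∈ pisotSet K}
  have hfin : S.Finite := (finite_smallConjSet_inter_Iic K R).subset fun x hx =>
    ⟨diffSet_subset_smallConjSet K
      ⟨θ, hθ, θ + x, hx.2.2, by linarith [hx.1], by ring⟩, hx.2.1⟩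
  obtain ⟨θ', hθ', hlt, hle⟩ := h
  obtain ⟨x, hx, hmin⟩ := Set.exists_min_image S id hfin
    ⟨θ' - θ, by simpa using hlt, by linarith, by simpa using hθ'⟩
  refine ⟨θ + x, hx.2.2, by linarith [hx.1], fun η hη hlt => ?_⟩
  have := hmin (η - θ) ⟨by linarith, by linarith [hx.2.1], by simpa using hη⟩
  simp only [id] at this
  linarith

variable [IsTotallyReal K]

lemma diffSet_eq_smallConjSet : diffSet K = smallConjSet K := by
  refine (diffSet_subset_smallConjSet K).antisymm ?_
  rintro _ ⟨b, rfl, hb, hpos, hσ⟩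
  obtain ⟨ε, hε, hεσ⟩ := exists_pos_forall_lt (fun σ : K →+* ℂ => σ ≠ idEmbedding K)
    (fun σ => 1 - ‖σ b‖ / 2) (fun σ h => by linarith [(hσ σ h).2])
  -- Centring `a` at `-b/2` puts `a + b` near `b/2`, so both fit in the window with slack `1 - ‖σ b‖
  -- / 2`.
  obtain ⟨a, ha, ha1, haσ⟩ := exists_integer_approx K (fun σ => -(σ b).re / 2) hε 1
  refine ⟨a, (mem_pisotSet_iff K _).2 ⟨a, rfl, ha, ha1, fun σ h => ?_⟩, (a : ℝ) + b,
    (mem_pisotSet_iff K _).2 ⟨a + b, by simp, ha.add hb, by linarith, fun σ h => ?_⟩,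
    by linarith, by ring⟩
  · have h1 := haσ σ h
    have h2 := hεσ σ h
    rw [norm_apply_eq_abs_re] at h2 ⊢
    rw [abs_lt] at h1 ⊢
    constructor <;> linarith [neg_abs_le (σ b).re, le_abs_self (σ b).re]
  · have h1 := haσ σ h
    have h2 := hεσ σ h
    rw [norm_apply_eq_abs_re] at h2 ⊢
    rw [map_add, Complex.add_re]
    rw [abs_lt] at h1 ⊢
    constructor <;> linarith [neg_abs_le (σ b).re, le_abs_self (σ b).re]

/-- A step of size less than 1 directed against the sign of each coordinate stays in `(-1, 1)`. One
positive integer per sign pattern suffices, and the sum of them all bounds each one. -/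
lemma exists_pisot_le_add : ∃ R : ℝ, ∀ θ ∈ pisotSet K, ∃ θ' ∈ pisotSet K,
    θ < θ' ∧ θ' ≤ θ + R := by
  classical
  have h : ∀ s : (K →+* ℂ) → Bool, ∃ b : K, IsIntegral ℤ b ∧ 0 < (b : ℝ) ∧
      ∀ σ : K →+* ℂ, σ ≠ idEmbedding K → |(σ b).re - if s σ then -(1 / 2) else 1 / 2| < 1 / 2 :=
    fun s => exists_integer_approx K _ (by norm_num) 0
  choose β hβ hpos hβσ using h
  refine ⟨∑ s, (β s : ℝ), fun θ hθ => ?_⟩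
  obtain ⟨a, rfl, ha, ha1, haσ⟩ := (mem_pisotSet_iff K θ).1 hθ
  let s : (K →+* ℂ) → Bool := fun σ => decide (0 ≤ (σ a).re)
  refine ⟨a + β s, (mem_pisotSet_iff K _).2 ⟨a + β s, by simp, ha.add (hβ s),
    by linarith [hpos s], fun σ h => ?_⟩, by linarith [hpos s], ?_⟩
  · have h1 := hβσ s σ h
    have h2 := haσ σ h
    rw [norm_apply_eq_abs_re] at h2 ⊢
    rw [map_add, Complex.add_re]
    rw [abs_lt] at h1 h2 ⊢
    by_cases h0 : 0 ≤ (σ a).re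
    · simp only [s, h0, decide_true, if_true] at h1
      constructor <;> linarith
    · simp only [s, h0, decide_false, Bool.false_eq_true, if_false] at h1
      rw [not_le] at h0
      constructor <;> linarith
  · have := Finset.single_le_sum (f := fun s => (β s : ℝ)) (fun s _ => (hpos s).le)
      (Finset.mem_univ s)
    linarith

lemma finite_gapSet : (gapSet K).Finite := by
  obtain ⟨R, hR⟩ := exists_pisot_le_add K
  refine (finite_smallConjSet_inter_Iic K R).subset fun x hx =>
    ⟨diffSet_subset_smallConjSet K (gapSet_subset_diffSet K hx), ?_⟩
  obtain ⟨θ, hθ, θ', hθ', hlt, hcons, rfl⟩ := hx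
  obtain ⟨η, hη, hlt, hle⟩ := hR θ hθ
  have := hcons η hη
  simp only [hlt, true_and, not_lt] at this
  simp only [Set.mem_Iic]
  linarith

/-- Pisot numbers near the corners of the window are followed by gaps with prescribed signs. -/
lemma two_pow_le_ncard_gapSet :
    2 ^ (Module.finrank ℚ K - 1) ≤ (gapSet K).ncard := by
  classical
  let B : Set K := {b | (b : ℝ) ∈ gapSet K}
  have : Finite B := ((finite_gapSet K).preimage Subtype.val_injective.injOn).to_subtype
  have hne : ∀ b ∈ B, b ≠ 0 := by
    rintro b ⟨θ, -, θ', -, hlt, -, h⟩ rfl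
    simp only [ZeroMemClass.coe_zero] at h
    linarith
  obtain ⟨δ₀, hδ₀, hδσ⟩ := exists_pos_forall_lt (fun _ : B × (K →+* ℂ) => True)
    (fun q => |(q.2 q.1.1).re|) (fun q _ => by
      rw [← norm_apply_eq_abs_re, norm_pos_iff, map_ne_zero]
      exact hne _ q.1.2)
  -- Every conjugate of every gap exceeds `δ` in modulus. The cap at 1 keeps the approximations
  -- below inside the window.
  let δ := min δ₀ 1
  have hδ : 0 < δ := lt_min hδ₀ one_pos
  have hδ1 : δ ≤ 1 := min_le_right _ _
  have hδ' : ∀ b ∈ B, ∀ σ : K →+* ℂ, δ < |(σ b).re| := fun b hb σ =>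
    (min_le_left _ _).trans_lt (hδσ (⟨b, hb⟩, σ) trivial)
  have key : ∀ s : {σ : K →+* ℂ // σ ≠ idEmbedding K} → Bool, ∃ b ∈ B,
      ∀ σ, s σ = decide ((σ.1 b).re < 0) := by
    intro s
    -- Coordinates of `a` lie within `δ` of `1` or `-1` according to `s`. The next Pisot number
    -- stays in the window yet differs by more than `δ`, so it must move inward and the sign of the
    -- gap reveals `s`. The value 0 at the identity is never used.
    obtain ⟨a, ha, ha1, haσ⟩ := exists_integer_approx K
      (fun σ => if h : σ ≠ idEmbedding K then
        (if s ⟨σ, h⟩ then 1 - δ / 2 else -(1 - δ / 2)) else 0) (half_pos hδ) 1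
    have hθ : (a : ℝ) ∈ pisotSet K := by
      refine (mem_pisotSet_iff K _).2 ⟨a, rfl, ha, ha1, fun σ h => ?_⟩
      have h1 := haσ σ h
      rw [dif_pos h] at h1
      rw [norm_apply_eq_abs_re]
      rw [abs_lt] at h1 ⊢
      split_ifs at h1 <;> constructor <;> linarith
    obtain ⟨R, hR⟩ := exists_pisot_le_add K
    obtain ⟨θ', hθ', hlt, hcons⟩ := exists_consecutive K hθ (hR _ hθ)
    obtain ⟨c, rfl, hc, hc1, hcσ⟩ := (mem_pisotSet_iff K θ').1 hθ'
    have hmem : c - a ∈ B := ⟨a, hθ, c, hθ', hlt, hcons, by simp⟩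
    refine ⟨c - a, hmem, fun ⟨σ, h⟩ => ?_⟩
    have h1 := haσ σ h
    have h2 := hcσ σ h
    have h3 := hδ' _ hmem σ
    rw [dif_pos h] at h1
    rw [norm_apply_eq_abs_re] at h2
    rw [map_sub, Complex.sub_re] at h3 ⊢
    rw [abs_lt] at h1 h2
    rw [lt_abs] at h3
    cases hs : s ⟨σ, h⟩
    · simp only [hs, Bool.false_eq_true, if_false] at h1
      symm
      rw [decide_eq_false_iff_not]
      rcases h3 with h3 | h3 <;> linarith
    · simp only [hs, if_true] at h1
      symm
      rw [decide_eq_true_iff]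
      rcases h3 with h3 | h3 <;> linarith
  choose g hgB hgs using key
  have hinj : Function.Injective fun s => (g s : ℝ) := by
    intro s t hst
    have : g s = g t := Subtype.val_injective hst
    funext σ
    rw [hgs s σ, hgs t σ, this]
  calc 2 ^ (Module.finrank ℚ K - 1)
      = Nat.card ({σ : K →+* ℂ // σ ≠ idEmbedding K} → Bool) := by
        rw [← Embeddings.card K ℂ, Nat.card_eq_fintype_card, Fintype.card_fun, Fintype.card_bool,
          Fintype.card_subtype_compl, Fintype.card_subtype_eq]
    _ = (Set.range fun s => (g s : ℝ)).ncard := by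
        rw [← Set.image_univ, Set.ncard_image_of_injective _ hinj, Set.ncard_univ]
    _ ≤ (gapSet K).ncard := Set.ncard_le_ncard
        (by rintro _ ⟨s, rfl⟩; exact hgB s) (finite_gapSet K)

end Gaps

/-! ### Differences below 2: root of unity traces -/

section RootTrace

/-- If `n ↦ cos (n t)` takes only finitely many values, then `t` is a rational multiple of
`2 π`. -/
lemma exists_mul_eq_of_finite {t : ℝ} (h : (Set.range fun n : ℕ => Real.cos (n * t)).Finite) :
    ∃ n : ℕ, 0 < n ∧ ∃ k : ℤ, (n : ℝ) * t = 2 * k * Real.pi := by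
  have hni : ¬ Function.Injective fun n : ℕ => Real.cos (n * t) := fun hinj =>
    Set.infinite_range_of_injective hinj h
  simp only [Function.Injective, not_forall] at hni
  obtain ⟨m, n, hmn, hne⟩ := hni
  wlog hlt : m < n generalizing m n
  · exact this n m hmn.symm (Ne.symm hne) (by omega)
  obtain ⟨k, hk | hk⟩ := Real.cos_eq_cos_iff.1 hmn
  · refine ⟨n - m, by omega, k, ?_⟩
    rw [Nat.cast_sub hlt.le]
    linarith
  · refine ⟨n + m, by omega, k, ?_⟩
    push_cast
    linarith

lemma isRootOfUnityTrace_of_mul_eq {t : ℝ} (h0 : 0 < t) (h1 : t < Real.pi)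
    (hcos : 0 < Real.cos t) {n : ℕ} (hn : 0 < n) {k : ℤ} (hk : (n : ℝ) * t = 2 * k * Real.pi) :
    IsRootOfUnityTrace (2 * Real.cos t) := by
  have hn' : (0 : ℝ) < n := by exact_mod_cast hn
  have hpi := Real.pi_pos
  have hkpos : 0 < k := by
    have : (0 : ℝ) < k := by
      by_contra hneg
      nlinarith [mul_pos hn' h0]
    exact_mod_cast this
  lift k to ℕ using hkpos.le
  have hk0 : 0 < k := by exact_mod_cast hkpos
  simp only [Int.cast_natCast] at hk
  let g := Nat.gcd k n
  have hg : 0 < g := Nat.gcd_pos_of_pos_left _ hk0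
  obtain ⟨k', hk'⟩ : g ∣ k := Nat.gcd_dvd_left k n
  obtain ⟨n', hn''⟩ : g ∣ n := Nat.gcd_dvd_right k n
  have hcop : Nat.Coprime k' n' := by
    have := Nat.coprime_div_gcd_div_gcd hg
    rw [show k / k.gcd n = k' from Nat.div_eq_of_eq_mul_right hg hk',
      show n / k.gcd n = n' from Nat.div_eq_of_eq_mul_right hg hn''] at this
    exact this
  have hg' : (0 : ℝ) < g := by exact_mod_cast hg
  have hkn : (n' : ℝ) * t = 2 * k' * Real.pi := by
    have e1 : (k : ℝ) = g * k' := by exact_mod_cast hk'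
    have e2 : (n : ℝ) = g * n' := by exact_mod_cast hn''
    rw [e1, e2] at hk
    have : (g : ℝ) * (n' * t) = g * (2 * k' * Real.pi) := by linarith
    exact mul_left_cancel₀ hg'.ne' this
  have hn1 : 0 < n' := Nat.pos_of_ne_zero (by rintro rfl; omega)
  have hk1 : 0 < k' := Nat.pos_of_ne_zero (by rintro rfl; omega)
  have hn1' : (0 : ℝ) < n' := by exact_mod_cast hn1
  have hlt : t < Real.pi / 2 := by
    by_contra hge
    have := Real.cos_nonpos_of_pi_div_two_le_of_le (not_lt.1 hge) (by linarith)
    linarith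
  -- Positivity of the cosine puts `t` below `π / 2`; in lowest terms this yields both `4 ≤ n'` and
  -- `k' < n'`.
  have h4 : 4 * k' < n' := by
    have : (4 * k' : ℝ) < n' := by
      by_contra hge
      nlinarith
    exact_mod_cast this
  refine ⟨by linarith, n', k', by omega, by omega, by omega, hcop, ?_⟩
  congr 2
  field_simp
  linarith

open Polynomial in
lemma norm_le_two_of_chebyshev {z : ℂ} {n : ℕ} (hn : 0 < n)
    (h : (Chebyshev.C ℂ n).eval z = 2) : ‖z‖ ≤ 2 := by
  obtain ⟨w, hw⟩ := Complex.cos_surjective (z / 2)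
  obtain rfl : z = 2 * Complex.cos w := by rw [hw]; ring
  rw [Chebyshev.C_two_mul_complex_cos] at h
  have h1 : Complex.cos (n * w) = 1 := by
    push_cast at h
    linear_combination h / 2
  obtain ⟨k, hk⟩ := Complex.cos_eq_one_iff.1 h1
  have hn' : (n : ℂ) ≠ 0 := by exact_mod_cast hn.ne'
  have hw' : w = ((k * (2 * Real.pi) / n : ℝ) : ℂ) := by
    push_cast
    field_simp
    linear_combination -hk
  rw [hw', ← Complex.ofReal_cos, norm_mul, Complex.norm_real, Real.norm_eq_abs]
  norm_num
  exact Real.abs_cos_le_one _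

variable (K : IntermediateField ℚ ℝ)

lemma one_mem_rootTraceSet : (1 : ℝ) ∈ rootTraceSet K := by
  refine ⟨⟨one_pos, 6, 1, by norm_num, le_rfl, by norm_num, by norm_num, ?_⟩, one_mem K⟩
  rw [show 2 * ((1 : ℕ) : ℝ) * Real.pi / (6 : ℕ) = Real.pi / 3 by push_cast; ring,
    Real.cos_pi_div_three]
  norm_num

open Polynomial in
lemma map_chebyshev_eval {A B : Type*} [CommRing A] [CommRing B] (f : A →+* B) (n : ℤ) (x : A) :
    f ((Chebyshev.C A n).eval x) = (Chebyshev.C B n).eval (f x) := by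
  rw [← Chebyshev.map_C f, eval_map, eval₂_at_apply]

open Polynomial in
lemma _root_.IsIntegral.chebyshev_eval {A : Type*} [CommRing A] {x : A} (hx : IsIntegral ℤ x)
    (n : ℤ) : IsIntegral ℤ ((Chebyshev.C A n).eval x) := by
  rw [show x = algebraMap (integralClosure ℤ A) A ⟨x, hx⟩ from rfl, ← map_chebyshev_eval]
  exact ((Chebyshev.C (integralClosure ℤ A) n).eval ⟨x, hx⟩).2

variable {K} in
-- A real conjugate of modulus 2 is `±2`, which is rational, so `b` would equal it. This upgrades
-- bounds `≤ 2` to strict ones.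
lemma norm_apply_ne_two [IsTotallyReal K] (σ : K →+* ℂ) {b : K} (hb : |(b : ℝ)| ≠ 2) :
    ‖σ b‖ ≠ 2 := by
  intro h
  rw [norm_apply_eq_abs_re] at h
  refine hb ?_
  rcases (abs_eq zero_le_two).1 h with h | h
  · have : σ b = σ 2 := by rw [← coe_re_apply σ b, h, map_ofNat]; norm_num
    rw [σ.injective this]
    exact abs_two
  · have : σ b = σ (-2) := by rw [← coe_re_apply σ b, h, map_neg, map_ofNat]; norm_num
    rw [σ.injective this]
    exact (abs_neg _).trans abs_two

variable [IsTotallyReal K]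

open Polynomial in
-- The equation `C_n(u) = 2` has integer coefficients, so it passes to all conjugates, and its
-- complex roots are of the form `2 cos (2πj/n)`.
lemma rootTraceSet_subset_smallConjSet : rootTraceSet K ⊆ smallConjSet K ∩ Set.Ioo 0 2 := by
  rintro u ⟨⟨hpos, n, k, hn, hk, hkn, -, hu⟩, huK⟩
  let b : K := ⟨u, huK⟩
  have hpi := Real.pi_pos
  have hn0 : (0 : ℝ) < n := by exact_mod_cast (by omega : 0 < n)
  have hk0 : (0 : ℝ) < k := by exact_mod_cast hk
  have hkn' : (k : ℝ) < n := by exact_mod_cast hkn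
  have hlt : u < 2 := by
    have hne : Real.cos (2 * (k : ℝ) * Real.pi / n) ≠ 1 := fun h => by
      have h1 : 0 < 2 * (k : ℝ) * Real.pi / n := by positivity
      have h2 : 2 * (k : ℝ) * Real.pi / n < 2 * Real.pi := by
        rw [div_lt_iff₀ hn0]
        nlinarith
      exact h1.ne' ((Real.cos_eq_one_iff_of_lt_of_lt (by linarith) h2).1 h)
    have := (Real.cos_le_one (2 * (k : ℝ) * Real.pi / n)).lt_of_ne hne
    linarith
  have hb : IsIntegral ℤ b := by
    rw [← isIntegral_algebraMap_iff (B := ℝ) (algebraMap K ℝ).injective]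
    have := Real.isIntegral_two_mul_cos_rat_mul_pi (2 * k / n)
    push_cast at this
    rw [show (2 * (k : ℝ) / n) * Real.pi = 2 * (k : ℝ) * Real.pi / n by ring, ← hu] at this
    exact this
  have hCb : (Chebyshev.C K n).eval b = 2 := by
    apply (algebraMap K ℝ).injective
    rw [map_chebyshev_eval, map_ofNat]
    change (Chebyshev.C ℝ n).eval u = 2
    rw [hu, Chebyshev.C_two_mul_real_cos,
      show ((n : ℤ) : ℝ) * (2 * (k : ℝ) * Real.pi / n) = k * (2 * Real.pi) by
        push_cast; field_simp,
      Real.cos_nat_mul_two_pi, mul_one]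
  refine ⟨⟨b, rfl, hb, hpos, fun σ _ => ⟨?_, lt_of_le_of_ne ?_ ?_⟩⟩, hpos, hlt⟩
  · rw [norm_pos_iff, _root_.map_ne_zero]
    intro h
    exact hpos.ne' (congrArg (fun x : K => (x : ℝ)) h)
  · refine norm_le_two_of_chebyshev (n := n) (by omega) ?_
    rw [← map_chebyshev_eval, hCb, map_ofNat]
  · intro h
    exact norm_apply_ne_two σ (b := b) (by rw [abs_of_pos hpos]; exact hlt.ne) h

variable [NumberField K]

open Polynomial in
-- Kronecker's argument: writing `b = 2 cos t`, the integers `C_n(b) = 2 cos (n t)` have all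
-- conjugates in `[-2, 2]`, so they take finitely many values and `t` is a rational multiple of `π`.
lemma smallConjSet_inter_Ioo_subset : smallConjSet K ∩ Set.Ioo 0 2 ⊆ rootTraceSet K := by
  rintro _ ⟨⟨b, rfl, hb, hpos, hσ⟩, -, hlt⟩
  refine ⟨?_, b.2⟩
  have hall : ∀ σ : K →+* ℂ, |(σ b).re| ≤ 2 := fun σ => by
    by_cases h : σ = idEmbedding K
    · rw [h, idEmbedding_apply, Complex.ofReal_re, abs_of_pos hpos]
      exact hlt.le
    · rw [← norm_apply_eq_abs_re]
      exact (hσ σ h).2.le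
  have hC : ∀ n : ℕ, (Chebyshev.C K n).eval b ∈
      {x : K | IsIntegral ℤ x ∧ ∀ σ : K →+* ℂ, ‖σ x‖ ≤ 2} := by
    intro n
    refine ⟨hb.chebyshev_eval n, fun σ => ?_⟩
    have h1 := abs_le.1 (hall σ)
    have ht := Real.cos_arccos (x := (σ b).re / 2) (by linarith) (by linarith)
    set t := Real.arccos ((σ b).re / 2)
    rw [map_chebyshev_eval, ← coe_re_apply σ b,
      show ((σ b).re : ℂ) = 2 * Complex.cos t by
        rw [← Complex.ofReal_cos, ht]; push_cast; ring,
      Chebyshev.C_two_mul_complex_cos,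
      show 2 * Complex.cos (((n : ℤ) : ℂ) * t) = ((2 * Real.cos (n * t) : ℝ) : ℂ) by push_cast; rfl,
      Complex.norm_real, Real.norm_eq_abs, abs_mul]
    norm_num
    exact Real.abs_cos_le_one _
  have ht := Real.cos_arccos (x := (b : ℝ) / 2) (by linarith) (by linarith)
  have ht0 : 0 < Real.arccos ((b : ℝ) / 2) := Real.arccos_pos.2 (by linarith)
  have ht1 : Real.arccos ((b : ℝ) / 2) < Real.pi := Real.arccos_lt_pi.2 (by linarith)
  set t := Real.arccos ((b : ℝ) / 2)
  have hbt : (b : ℝ) = 2 * Real.cos t := by rw [ht]; ring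
  obtain ⟨n, hn, k, hk⟩ := exists_mul_eq_of_finite (t := t) <| by
    refine ((Embeddings.finite_of_norm_le K ℂ 2).image (fun x : K => (x : ℝ) / 2)).subset ?_
    rintro _ ⟨n, rfl⟩
    refine ⟨_, hC n, ?_⟩
    have h1 := map_chebyshev_eval (algebraMap K ℝ) n b
    simp only [IntermediateField.algebraMap_apply] at h1
    simp only [h1, hbt, Chebyshev.C_two_mul_real_cos, Int.cast_natCast]
    ring
  rw [hbt]
  exact isRootOfUnityTrace_of_mul_eq ht0 ht1 (by rw [ht]; linarith) hn hk

lemma rootTraceSet_eq : rootTraceSet K = smallConjSet K ∩ Set.Ioo 0 2 :=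
  (rootTraceSet_subset_smallConjSet K).antisymm (smallConjSet_inter_Ioo_subset K)

end RootTrace

/-! ### Differences above 2: Salem traces -/

section Salem

/-- `X² - xX + 1` has negative discriminant, so its roots are complex conjugates with product 1. -/
lemma norm_eq_one_of_add_inv {z : ℂ} (hz : z ≠ 0) {x : ℝ} (h : z + z⁻¹ = x) (hx : |x| < 2) :
    ‖z‖ = 1 := by
  have h1 : z * z + 1 = x * z := by
    rw [← h]
    field_simp
  have hre := congrArg Complex.re h1
  have him := congrArg Complex.im h1
  simp only [Complex.add_re, Complex.mul_re, Complex.one_re, Complex.ofReal_re, Complex.ofReal_im,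
    Complex.add_im, Complex.mul_im, Complex.one_im, zero_mul, sub_zero, add_zero] at hre him
  rw [abs_lt] at hx
  have hsq : z.re * z.re + z.im * z.im = 1 := by
    have him' : z.im * (2 * z.re - x) = 0 := by linarith
    rcases mul_eq_zero.1 him' with h0 | h0
    · rw [h0] at hre
      nlinarith [sq_nonneg (z.re - x / 2)]
    · obtain rfl : x = 2 * z.re := by linarith
      linarith
  rw [← Complex.normSq_apply, Complex.normSq_eq_norm_sq] at hsq
  exact (pow_eq_one_iff_of_nonneg (norm_nonneg z) two_ne_zero).1 hsq

lemma eq_or_eq_inv_of_add_inv_eq {F : Type*} [Field F] {z w : F} (hz : z ≠ 0) (hw : w ≠ 0)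
    (h : z + z⁻¹ = w + w⁻¹) : z = w ∨ z = w⁻¹ := by
  have : (z - w) * (z - w⁻¹) = 0 := by
    have h1 : z * (z + z⁻¹) = z * (w + w⁻¹) := by rw [h]
    rw [mul_add, mul_inv_cancel₀ hz] at h1
    rw [sub_mul, mul_sub, mul_sub, mul_inv_cancel₀ hw]
    linear_combination h1
  rcases mul_eq_zero.1 this with h | h
  · exact Or.inl (sub_eq_zero.1 h)
  · exact Or.inr (sub_eq_zero.1 h)

lemma exists_numberField_mem {τ : ℝ} (hτ : IsIntegral ℚ τ) :
    ∃ (L : IntermediateField ℚ ℝ) (_ : NumberField L), τ ∈ L := by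
  have hadj := IntermediateField.adjoin.finiteDimensional hτ
  exact ⟨IntermediateField.adjoin ℚ {τ},
    { to_charZero := inferInstance, to_finiteDimensional := hadj },
    IntermediateField.mem_adjoin_simple_self ℚ τ⟩

/-- If `z` is a conjugate on the unit circle, then `z⁻¹` is its complex conjugate, hence also
conjugate to `τ`. Carrying `z` back to `τ` makes `τ⁻¹` conjugate to `τ`, and so an integer too. -/
lemma IsSalem.isConjRoot_inv_and_isIntegral_inv {τ : ℝ} (h : IsSalem τ) :
    IsConjRoot ℚ τ τ⁻¹ ∧ IsIntegral ℤ τ⁻¹ := by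
  obtain ⟨hint, h1, -, z, hz, hz1⟩ := h
  have hτ : IsIntegral ℚ τ := hint.tower_top
  obtain ⟨L, _, hL⟩ := exists_numberField_mem hτ
  let t : L := ⟨τ, hL⟩
  obtain ⟨ψ, rfl⟩ := (isConjRoot_coe_iff t z).1 hz
  have hzt : IsConjRoot ℚ ((t : ℝ) : ℂ) (starRingEnd ℂ (ψ t)) :=
    (isConjRoot_coe_iff t _).2 ⟨(starRingEnd ℂ).comp ψ, rfl⟩
  have hinv : starRingEnd ℂ (ψ t) = ψ t⁻¹ := by
    rw [map_inv₀]
    refine eq_inv_of_mul_eq_one_left ?_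
    rw [mul_comm, Complex.mul_conj, Complex.normSq_eq_norm_sq, hz1]
    norm_num
  rw [hinv] at hzt
  have e1 : minpoly ℚ ((t : ℝ) : ℂ) = minpoly ℚ τ :=
    minpoly.algHom_eq Complex.ofRealHom.toRatAlgHom Complex.ofRealHom.injective τ
  have e2 : minpoly ℚ (ψ t⁻¹) = minpoly ℚ t⁻¹ := minpoly.algHom_eq ψ.toRatAlgHom ψ.injective _
  have e3 : minpoly ℚ ((t⁻¹ : L) : ℝ) = minpoly ℚ t⁻¹ := minpoly.algHom_eq L.val L.val.injective t⁻¹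
  have hconj : IsConjRoot ℚ τ τ⁻¹ := by
    rw [isConjRoot_def, ← e1, show τ⁻¹ = ((t⁻¹ : L) : ℝ) by simp [t], e3, ← e2]
    exact hzt
  refine ⟨hconj, ?_⟩
  obtain ⟨p, hp, hp0⟩ := hint
  refine ⟨p, hp, ?_⟩
  have hdvd : minpoly ℚ τ ∣ p.map (algebraMap ℤ ℚ) := minpoly.dvd _ _ (by
    rw [Polynomial.aeval_map_algebraMap]
    exact hp0)
  rw [hconj] at hdvd
  have := (minpoly.dvd_iff).1 hdvd
  rwa [Polynomial.aeval_map_algebraMap] at this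

lemma isIntegral_of_add_inv_eq {τ : ℝ} (hτ : τ ≠ 0) (h : IsIntegral ℤ (τ + τ⁻¹)) :
    IsIntegral ℤ τ := by
  let A := integralClosure ℤ ℝ
  let b : A := ⟨τ + τ⁻¹, h⟩
  refine isIntegral_trans (A := A) τ ⟨.X ^ 2 - .C b * .X + .C 1, by monicity!, ?_⟩
  simp only [Polynomial.eval₂_add, Polynomial.eval₂_sub, Polynomial.eval₂_mul,
    Polynomial.eval₂_pow, Polynomial.eval₂_X, Polynomial.eval₂_C,
    Polynomial.eval₂_one, map_one]
  change τ ^ 2 - (τ + τ⁻¹) * τ + 1 = 0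
  field_simp
  ring

variable (K : IntermediateField ℚ ℝ) [NumberField K]

lemma adjoin_eq_of_mem_salemTraceSet {β : ℝ} (h : β ∈ salemTraceSet K) :
    β ∈ K ∧ IntermediateField.adjoin ℚ {β} = K := by
  obtain ⟨⟨b, rfl, -, -, hσ⟩, hlt⟩ := h
  exact ⟨b.2, adjoin_eq_of_norm_lt (le_of_lt hlt) fun σ h => (hσ σ h).2⟩

/-- Take for `τ` the larger root of `X² - βX + 1`. A conjugate of `τ` lying over `β` itself is `τ`
or `τ⁻¹`; over any other embedding it lies on the unit circle, and `2 ≤ d` provides such an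
embedding. -/
lemma isSalemTrace_of_mem_salemTraceSet [IsTotallyReal K] (hd : 2 ≤ Module.finrank ℚ K) {β : ℝ}
    (h : β ∈ salemTraceSet K) : IsSalemTrace β := by
  obtain ⟨⟨b, rfl, hb, -, hσ⟩, hlt⟩ := h
  have hlt : 2 < (b : ℝ) := hlt
  have hs : 0 ≤ (b : ℝ) ^ 2 - 4 := by nlinarith
  let τ : ℝ := ((b : ℝ) + √((b : ℝ) ^ 2 - 4)) / 2
  have hτ1 : 1 < τ := by
    have := Real.sqrt_nonneg ((b : ℝ) ^ 2 - 4)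
    simp only [τ]
    linarith
  have hτ0 : τ ≠ 0 := by linarith
  have hsum : τ + τ⁻¹ = b := by
    have h1 : τ * τ + 1 = b * τ := by
      have := Real.mul_self_sqrt hs
      simp only [τ]
      linear_combination this / 4
    field_simp
    linarith
  have hint : IsIntegral ℤ τ := isIntegral_of_add_inv_eq hτ0 (by
    rw [hsum]
    exact hb.map (algebraMap K ℝ).toIntAlgHom)
  obtain ⟨L, _, hL⟩ := exists_numberField_mem (τ := τ) hint.tower_top
  let t : L := ⟨τ, hL⟩
  have htb : ((t + t⁻¹ : L) : ℝ) = b := by simpa [t] using hsum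
  have ht0 : t ≠ 0 := fun h => hτ0 (congrArg (fun x : L => (x : ℝ)) h)
  have hunit : ∀ σ : K →+* ℂ, σ ≠ idEmbedding K → ∀ ψ : L →+* ℂ, ψ (t + t⁻¹) = σ b →
      ‖ψ t‖ = 1 := by
    intro σ hne ψ hψ
    have hlt := (hσ σ hne).2
    rw [norm_apply_eq_abs_re] at hlt
    rw [map_add, map_inv₀, ← coe_re_apply σ b] at hψ
    exact norm_eq_one_of_add_inv ((map_ne_zero ψ).2 ht0) hψ hlt
  refine ⟨τ, ⟨hint, hτ1, fun z hz hne => ?_, ?_⟩, hsum.symm⟩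
  · obtain ⟨ψ, rfl⟩ := (isConjRoot_coe_iff t z).1 hz
    obtain ⟨σ, hψ⟩ := (isConjRoot_coe_iff b (ψ (t + t⁻¹))).1 (by
      rw [← htb]
      exact (isConjRoot_coe_iff _ _).2 ⟨ψ, rfl⟩)
    by_cases h : σ = idEmbedding K
    · rw [h, idEmbedding_apply, ← hsum, map_add, map_inv₀] at hψ
      push_cast at hψ
      rcases eq_or_eq_inv_of_add_inv_eq ((map_ne_zero ψ).2 ht0)
        (by exact_mod_cast hτ0) hψ.symm with h | h
      · exact absurd h hne
      · rw [h, norm_inv, Complex.norm_real, Real.norm_eq_abs]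
        exact inv_le_one_of_one_le₀ (hτ1.le.trans (le_abs_self _))
    · exact (hunit σ h ψ hψ.symm).le
  · obtain ⟨σ, hne⟩ := exists_ne_idEmbedding K hd
    obtain ⟨ψ, hψ⟩ := (isConjRoot_coe_iff (t + t⁻¹) (σ b)).1 (by
      rw [htb]
      exact (isConjRoot_coe_iff _ _).2 ⟨σ, rfl⟩)
    exact ⟨ψ t, (isConjRoot_coe_iff t _).2 ⟨ψ, rfl⟩, hunit σ hne ψ hψ⟩

lemma mem_salemTraceSet_of_isSalemTrace [IsTotallyReal K] {β : ℝ} (h : IsSalemTrace β)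
    (hK : β ∈ K) (hadj : IntermediateField.adjoin ℚ {β} = K) : β ∈ salemTraceSet K := by
  obtain ⟨τ, hτ, hβ⟩ := h
  obtain ⟨hconj, hinv⟩ := hτ.isConjRoot_inv_and_isIntegral_inv
  obtain ⟨hint, h1, hle, -⟩ := hτ
  have hτ0 : τ ≠ 0 := by linarith
  let b : K := ⟨β, hK⟩
  have hb : IsIntegral ℤ b := by
    rw [← isIntegral_algebraMap_iff (B := ℝ) (algebraMap K ℝ).injective]
    change IsIntegral ℤ β
    rw [hβ]
    exact hint.add hinv
  have h2 : 2 < β := by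
    have hτpos : 0 < τ := by linarith
    have : 0 < (τ - 1) ^ 2 / τ := div_pos (pow_pos (by linarith) 2) hτpos
    have e : (τ - 1) ^ 2 / τ = τ + τ⁻¹ - 2 := by field_simp; ring
    rw [hβ]
    linarith
  obtain ⟨L, _, hL⟩ := exists_numberField_mem (τ := τ) hint.tower_top
  let t : L := ⟨τ, hL⟩
  have ht0 : t ≠ 0 := fun h => hτ0 (congrArg (fun x : L => (x : ℝ)) h)
  have htb : ((t + t⁻¹ : L) : ℝ) = b := by simp [t, b, hβ]
  refine ⟨⟨b, rfl, hb, (by linarith : (0 : ℝ) < β), fun σ hne => ?_⟩, h2⟩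
  have hσb : σ b ≠ ((b : ℝ) : ℂ) := fun h => hne ((adjoin_eq_iff b).1 hadj σ h)
  obtain ⟨ψ, hψ⟩ := (isConjRoot_coe_iff (t + t⁻¹) (σ b)).1 (by
    rw [htb]
    exact (isConjRoot_coe_iff _ _).2 ⟨σ, rfl⟩)
  rw [map_add, map_inv₀] at hψ
  have hb' : ((b : ℝ) : ℂ) = (τ : ℂ) + (τ : ℂ)⁻¹ := by
    rw [← htb]
    simp [t]
  have c1 : IsConjRoot ℚ (τ : ℂ) (ψ t) := (isConjRoot_coe_iff t _).2 ⟨ψ, rfl⟩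
  have c2 : IsConjRoot ℚ (τ : ℂ) (ψ t)⁻¹ := by
    have h3 : IsConjRoot ℚ ((t⁻¹ : L) : ℂ) (ψ t⁻¹) := (isConjRoot_coe_iff t⁻¹ _).2 ⟨ψ, rfl⟩
    rw [map_inv₀] at h3
    refine IsConjRoot.trans ?_ h3
    have := (isConjRoot_algHom_iff Complex.ofRealHom.toRatAlgHom).2 hconj
    simpa [t] using this
  -- If `ψ t` or its inverse were `τ`, then `σ` would fix the generator `b`. So both have modulus at
  -- most 1 and their sum at most 2.
  have n1 := hle _ c1 fun h => hσb (by rw [← hψ, h, hb'])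
  have n2 := hle _ c2 fun h => hσb (by
    rw [← hψ, hb', ← h, inv_inv, add_comm])
  have hb0 : b ≠ 0 := fun h => by
    have : β = 0 := congrArg (fun x : K => (x : ℝ)) h
    linarith
  refine ⟨norm_pos_iff.2 ((map_ne_zero σ).2 hb0), lt_of_le_of_ne ?_ ?_⟩
  · rw [← hψ]
    linarith [norm_add_le (ψ t) (ψ t)⁻¹]
  · refine norm_apply_ne_two σ ?_
    rw [abs_of_pos (by linarith : (0 : ℝ) < β)]
    exact h2.ne'

end Salem

/-! ### The two smallest gaps -/

section LeastGaps

lemma exists_isLeast_of_finite_inter_Iic {S : Set ℝ} (hS : S.Nonempty)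
    (hfin : ∀ R, (S ∩ Set.Iic R).Finite) : ∃ x, IsLeast S x := by
  obtain ⟨y, hy⟩ := hS
  obtain ⟨x, hx, hmin⟩ := Set.exists_min_image _ id (hfin y) ⟨y, hy, le_refl y⟩
  refine ⟨x, hx.1, fun z hz => ?_⟩
  rcases le_total z y with h | h
  · exact hmin z ⟨hz, h⟩
  · exact (show x ≤ y from hx.2).trans h

variable (K : IntermediateField ℚ ℝ)

/-- A Pisot number strictly between the two endpoints splits the difference. -/
lemma mem_gapSet_or_exists_add {x : ℝ} (hx : x ∈ diffSet K) :
    x ∈ gapSet K ∨ ∃ y ∈ diffSet K, ∃ z ∈ diffSet K, x = y + z := by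
  obtain ⟨θ, hθ, θ', hθ', hlt, rfl⟩ := hx
  by_cases h : ∀ η ∈ pisotSet K, ¬ (θ < η ∧ η < θ')
  · exact Or.inl ⟨θ, hθ, θ', hθ', hlt, h, rfl⟩
  · push Not at h
    obtain ⟨η, hη, h1, h2⟩ := h
    exact Or.inr ⟨η - θ, ⟨θ, hθ, η, hη, h1, rfl⟩, θ' - η, ⟨η, hη, θ', hθ', h2, rfl⟩, by ring⟩

lemma pos_of_mem_diffSet {x : ℝ} (hx : x ∈ diffSet K) : 0 < x := by
  obtain ⟨θ, -, θ', -, hlt, rfl⟩ := hx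
  exact sub_pos.2 hlt

lemma isLeast_gapSet {u : ℝ} (hu : IsLeast (diffSet K) u) : IsLeast (gapSet K) u := by
  refine ⟨?_, fun x hx => hu.2 (gapSet_subset_diffSet K hx)⟩
  rcases mem_gapSet_or_exists_add K hu.1 with h | ⟨y, hy, z, hz, h⟩
  · exact h
  · linarith [hu.2 hy, pos_of_mem_diffSet K hz]

variable [NumberField K]

/-- The norm of `b` is a nonzero integer, so if all other conjugates were below 1 then `|b| ≥ 1`.
Hence `b = ±1`, whose other conjugates have modulus 1, a contradiction. -/
lemma exists_one_le_norm (hd : 2 ≤ Module.finrank ℚ K) {b : K} (hb : IsIntegral ℤ b)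
    (hb0 : b ≠ 0) (hb1 : |(b : ℝ)| ≤ 1) : ∃ σ : K →+* ℂ, σ ≠ idEmbedding K ∧ 1 ≤ ‖σ b‖ := by
  by_contra! hcon
  have h1 := InfinitePlace.one_le_of_lt_one (w := InfinitePlace.mk (idEmbedding K))
    (a := (⟨b, hb⟩ : 𝓞 K)) (fun h => hb0 (congrArg (fun x : 𝓞 K => (x : K)) h)) (by
      intro w hw
      rw [← InfinitePlace.mk_embedding w, InfinitePlace.apply]
      refine hcon _ fun h => hw ?_
      rw [← InfinitePlace.mk_embedding w, h])
  rw [InfinitePlace.apply] at h1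
  change 1 ≤ ‖idEmbedding K b‖ at h1
  rw [norm_idEmbedding] at h1
  obtain ⟨σ, hσ⟩ := exists_ne_idEmbedding K hd
  have h2 := hcon σ hσ
  rcases (abs_eq zero_le_one).1 (le_antisymm hb1 h1) with h | h
  · obtain rfl : b = 1 := Subtype.val_injective h
    simp at h2
  · obtain rfl : b = -1 := Subtype.val_injective (by simpa using h)
    simp at h2

lemma algDegree_eq_finrank_iff {β : ℝ} (hβ : β ∈ K) :
    algDegree β = Module.finrank ℚ K ↔ IntermediateField.adjoin ℚ {β} = K := by
  have hint : IsIntegral ℚ β :=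
    (Algebra.IsIntegral.isIntegral (R := ℚ) (⟨β, hβ⟩ : K)).map K.val
  rw [algDegree, ← IntermediateField.adjoin.finrank hint]
  refine ⟨fun h => ?_, fun h => by rw [h]⟩
  have hle : IntermediateField.adjoin ℚ {β} ≤ K := by
    rwa [IntermediateField.adjoin_simple_le_iff]
  exact IntermediateField.eq_of_le_of_finrank_eq hle h

variable [IsTotallyReal K]

/-- Unless it is a gap, the second smallest difference is twice the smallest one `u`, and then
all the conjugates of `u` are too small. -/
lemma isLeast_gapSet_diff (hd : 2 ≤ Module.finrank ℚ K) {u v : ℝ} (hu : IsLeast (diffSet K) u)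
    (hu1 : u ≤ 1) (hv : IsLeast (diffSet K \ {u}) v) : IsLeast (gapSet K \ {u}) v := by
  refine ⟨⟨?_, hv.1.2⟩, fun x hx => hv.2 ⟨gapSet_subset_diffSet K hx.1, hx.2⟩⟩
  rcases mem_gapSet_or_exists_add K hv.1.1 with h | ⟨y, hy, z, hz, h⟩
  · exact h
  exfalso
  have hlt : ∀ x ∈ diffSet K, x < v → x = u := fun x hx hxv => by
    by_contra hne
    linarith [hv.2 ⟨hx, hne⟩]
  have hyu := hlt y hy (by linarith [pos_of_mem_diffSet K hz])
  have hzu := hlt z hz (by linarith [pos_of_mem_diffSet K hy])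
  have hu' := hu.1
  have hv' := hv.1.1
  rw [diffSet_eq_smallConjSet] at hu' hv'
  obtain ⟨b, rfl, hb, hpos, -⟩ := hu'
  obtain ⟨c, rfl, -, -, hcσ⟩ := hv'
  obtain ⟨σ, hσ, h1⟩ := exists_one_le_norm K hd hb
    (fun h => hpos.ne' (congrArg (fun x : K => (x : ℝ)) h)) (by rwa [abs_of_pos hpos])
  obtain rfl : c = 2 * b := Subtype.val_injective (by
    rw [h, hyu, hzu, ← two_mul]
    rfl)
  have h2 := (hcσ σ hσ).2
  rw [map_mul, norm_mul, map_ofNat, Complex.norm_ofNat] at h2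
  linarith

lemma nonempty_salemTraceSet : (salemTraceSet K).Nonempty := by
  -- Centre 1 and radius 1 put the other conjugates in `(0, 2)`.
  obtain ⟨a, ha, h2, haσ⟩ := exists_integer_approx K (fun _ => 1) one_pos 2
  refine ⟨a, ⟨a, rfl, ha, by linarith, fun σ hσ => ?_⟩, h2⟩
  have := abs_lt.1 (haσ σ hσ)
  rw [norm_apply_eq_abs_re, abs_of_pos (by linarith)]
  constructor <;> linarith

lemma smallConjSet_eq_union (hd : 2 ≤ Module.finrank ℚ K) :
    smallConjSet K = salemTraceSet K ∪ rootTraceSet K := by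
  rw [rootTraceSet_eq, salemTraceSet, ← Set.inter_union_distrib_left, eq_comm,
    Set.inter_eq_left]
  rintro _ ⟨b, rfl, hb, hpos, hσ⟩
  rcases lt_trichotomy (b : ℝ) 2 with h | h | h
  · exact Or.inr ⟨hpos, h⟩
  · obtain ⟨σ, hne⟩ := exists_ne_idEmbedding K hd
    obtain rfl : b = 2 := Subtype.val_injective h
    have h2 : ‖σ 2‖ < 2 := (hσ σ hne).2
    rw [map_ofNat, Complex.norm_ofNat] at h2
    exact absurd h2 (lt_irrefl _)
  · exact Or.inl h

lemma salemTraceSet_eq (hd : 2 ≤ Module.finrank ℚ K) : salemTraceSet K =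
    {β : ℝ | IsSalemTrace β ∧ β ∈ K ∧ IntermediateField.adjoin ℚ {β} = K} := by
  ext β
  exact ⟨fun h => ⟨isSalemTrace_of_mem_salemTraceSet K hd h, adjoin_eq_of_mem_salemTraceSet K h⟩,
    fun h => mem_salemTraceSet_of_isSalemTrace K h.1 h.2.1 h.2.2⟩

lemma salemTraceSet_eq_algDegree (hd : 2 ≤ Module.finrank ℚ K) : salemTraceSet K =
    {β : ℝ | IsSalemTrace β ∧ β ∈ K ∧ algDegree β = Module.finrank ℚ K} := by
  rw [salemTraceSet_eq K hd]
  ext β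
  exact ⟨fun h => ⟨h.1, h.2.1, (algDegree_eq_finrank_iff K h.2.1).2 h.2.2⟩,
    fun h => ⟨h.1, h.2.1, (algDegree_eq_finrank_iff K h.2.1).1 h.2.2⟩⟩

lemma disjoint_salemTraceSet_rootTraceSet : Disjoint (salemTraceSet K) (rootTraceSet K) := by
  rw [rootTraceSet_eq, Set.disjoint_left]
  exact fun x h1 h2 => lt_asymm h1.2 h2.2.2

lemma finite_rootTraceSet : (rootTraceSet K).Finite := by
  rw [rootTraceSet_eq]
  exact (finite_smallConjSet_inter_Iic K 2).subset fun x hx => ⟨hx.1, hx.2.2.le⟩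

lemma isLeast_diffSet_of_isLeast_rootTraceSet (hd : 2 ≤ Module.finrank ℚ K) {u : ℝ}
    (hu : IsLeast (rootTraceSet K) u) : IsLeast (diffSet K) u := by
  rw [diffSet_eq_smallConjSet, smallConjSet_eq_union K hd]
  refine ⟨Or.inr hu.1, fun x hx => ?_⟩
  rcases hx with hx | hx
  · have : u ≤ 1 := hu.2 (one_mem_rootTraceSet K)
    have : 2 < x := hx.2
    linarith
  · exact hu.2 hx

lemma isLeast_diffSet_diff_of_isLeast_rootTraceSet_diff (hd : 2 ≤ Module.finrank ℚ K) {u v : ℝ}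
    (hv : IsLeast (rootTraceSet K \ {u}) v) : IsLeast (diffSet K \ {u}) v := by
  have hv2 := hv.1.1
  rw [rootTraceSet_eq] at hv2
  rw [diffSet_eq_smallConjSet]
  refine ⟨⟨hv2.1, hv.1.2⟩, fun x ⟨hx, hne⟩ => ?_⟩
  rw [smallConjSet_eq_union K hd] at hx
  rcases hx with hx | hx
  · exact (hv2.2.2.trans hx.2).le
  · exact hv.2 ⟨hx, hne⟩

end LeastGaps

end PisotGaps

/-! ### Assembly of the theorem -/

open PisotGaps in
theorem theorem1p3 (K : IntermediateField ℚ ℝ) [NumberField K] [NumberField.IsTotallyReal K]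
    (d : ℕ) (hd : Module.finrank ℚ K = d) (hd2 : 2 ≤ d) :
    -- (i)
    PisotGaps.diffSet K = PisotGaps.smallConjSet K ∧
    -- (ii)
    (PisotGaps.rootTraceSet K = PisotGaps.smallConjSet K ∩ Set.Ioo 0 2 ∧
      PisotGaps.rootTraceSet K = PisotGaps.diffSet K ∩ Set.Ioo 0 2) ∧
    -- (iii)
    (PisotGaps.salemTraceSet K = PisotGaps.diffSet K ∩ Set.Ioi 2 ∧
      PisotGaps.salemTraceSet K =
        {β : ℝ | PisotGaps.IsSalemTrace β ∧ β ∈ K ∧ IntermediateField.adjoin ℚ {β} = K} ∧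
      (PisotGaps.salemTraceSet K).Nonempty ∧
      (PisotGaps.rootTraceSet K).Nonempty ∧
      Disjoint (PisotGaps.salemTraceSet K) (PisotGaps.rootTraceSet K) ∧
      PisotGaps.salemTraceSet K ∪ PisotGaps.rootTraceSet K = PisotGaps.diffSet K ∧
      ∀ β ∈ PisotGaps.salemTraceSet K, PisotGaps.algDegree β = d) ∧
    -- (iv)
    ((PisotGaps.gapSet K).Finite ∧ 2 ^ (d - 1) ≤ (PisotGaps.gapSet K).ncard) ∧
    -- (v)
    ((PisotGaps.rootTraceSet K).Finite ∧
      PisotGaps.gapSet K ∩ Set.Ioo 0 2 ⊆ PisotGaps.rootTraceSet K ∧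
      (∃ u₁ : ℝ, IsLeast (PisotGaps.rootTraceSet K) u₁ ∧ IsLeast (PisotGaps.gapSet K) u₁ ∧
        u₁ ≤ 1) ∧
      (2 ≤ (PisotGaps.rootTraceSet K).ncard →
        ∃ u₂ : ℝ, PisotGaps.IsSecondLeast (PisotGaps.rootTraceSet K) u₂ ∧
          PisotGaps.IsSecondLeast (PisotGaps.gapSet K) u₂)) ∧
    -- (vi)
    ((PisotGaps.rootTraceSet K).ncard = 1 →
      IsLeast (PisotGaps.gapSet K) 1 ∧
      ∃ t : ℝ, PisotGaps.IsSecondLeast (PisotGaps.gapSet K) t ∧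
        IsLeast (PisotGaps.salemTraceSet K) t ∧
        IsLeast {β : ℝ | PisotGaps.IsSalemTrace β ∧ β ∈ K ∧ PisotGaps.algDegree β = d} t) := by
  subst hd
  have hrt := rootTraceSet_eq K
  have hun := smallConjSet_eq_union K hd2
  have hde := diffSet_eq_smallConjSet K
  obtain ⟨u, hu⟩ : ∃ u, IsLeast (rootTraceSet K) u :=
    exists_isLeast_of_finite_inter_Iic ⟨1, one_mem_rootTraceSet K⟩
      fun R => (finite_rootTraceSet K).subset Set.inter_subset_left
  have hu1 : u ≤ 1 := hu.2 (one_mem_rootTraceSet K)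
  have huD := isLeast_diffSet_of_isLeast_rootTraceSet K hd2 hu
  have huF := isLeast_gapSet K huD
  refine ⟨hde, ⟨hrt, by rw [hde, hrt]⟩, ⟨by rw [hde]; rfl, salemTraceSet_eq K hd2,
    nonempty_salemTraceSet K, ⟨1, one_mem_rootTraceSet K⟩, disjoint_salemTraceSet_rootTraceSet K,
    by rw [hde, hun], fun β hβ => ?_⟩, ⟨finite_gapSet K, two_pow_le_ncard_gapSet K⟩,
    ⟨finite_rootTraceSet K, fun x hx => ?_, ⟨u, hu, huF, hu1⟩, fun hcard => ?_⟩, fun hcard => ?_⟩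
  · rw [salemTraceSet_eq_algDegree K hd2] at hβ
    exact hβ.2.2
  · rw [hrt, ← hde]
    exact ⟨gapSet_subset_diffSet K hx.1, hx.2⟩
  · obtain ⟨v, hv⟩ : ∃ v, IsLeast (rootTraceSet K \ {u}) v :=
      exists_isLeast_of_finite_inter_Iic
        ((Set.one_lt_ncard_iff_nontrivial_and_finite.1 hcard).1.exists_ne u)
        fun R => (finite_rootTraceSet K).subset fun x hx => hx.1.1
    have hvD := isLeast_diffSet_diff_of_isLeast_rootTraceSet_diff K hd2 hv
    exact ⟨v, ⟨u, hu, hv⟩, u, huF, isLeast_gapSet_diff K hd2 huD hu1 hvD⟩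
  · obtain ⟨w, hw⟩ := Set.ncard_eq_one.1 hcard
    obtain rfl : w = 1 := by
      have := one_mem_rootTraceSet K
      rw [hw] at this
      exact (Set.mem_singleton_iff.1 this).symm
    obtain rfl : u = 1 := by
      have := hu.1
      rwa [hw] at this
    obtain ⟨t, ht⟩ : ∃ t, IsLeast (salemTraceSet K) t :=
      exists_isLeast_of_finite_inter_Iic (nonempty_salemTraceSet K)
        fun R => (finite_smallConjSet_inter_Iic K R).subset fun x hx => ⟨hx.1.1, hx.2⟩
    -- With 1 the only root of unity trace, the differences other than 1 are exactly the Salem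
    -- traces, so the second smallest difference is their minimum.
    have hDT : diffSet K \ {1} = salemTraceSet K := by
      rw [hde, hun, ← hw, Set.union_sdiff_right,
        (disjoint_salemTraceSet_rootTraceSet K).sdiff_eq_left]
    refine ⟨huF, t, ⟨1, huF, isLeast_gapSet_diff K hd2 huD hu1 (by rwa [hDT])⟩, ht, ?_⟩
    rwa [← salemTraceSet_eq_algDegree K hd2]
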